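/- Call a Borel probability measure $\mu$ on $[0,1]$ admissible if it is non-atomic and $0,1\in\operatorname{supp}\mu$. For such $\mu$, let $\mathcal D_\mu^2$ be the set of all $f\in C^1([0,1])$ for which there is $(f')^\mu\in L^2([0,1],\mu)$ with $f'(x)=f'(0)+\int_0^x (f')^\mu\,d\mu$ for all $x\in[0,1]$. For $b\in\{N,D\}$ let $\Delta_\mu^b$ be the Krein–Feller operator on $L^2([0,1],\mu)$ whose domain consists of the classes with a representative $\bar f\in\mathcal D_\mu^2$ satisfying $\bar f'(0)=\bar f'(1)=0$ if $b=N$ and $\bar f(0)=\bar f(1)=0$ if $b=D$, with $\Delta_\mu^b f=(\bar f')^\mu$; for $\lambda>0$ let $R_\lambda^b=(\lambda-\Delta_\mu^b)^{-1}$. Let $(C[0,1])_\mu^N$ be the space of all classes in $L^2([0,1],\mu)$ that possess a continuous representative on $[0,1]$, and $(C[0,1])_\mu^D$ the space of those that possess a continuous representative vanishing at $0$ and $1$; both carry the norm $\|f\|_\infty=\sup_{x\in\operatorname{supp}\mu}|f(x)|$, where $f(x)$ is evaluated with a continuous representative. Let $\mu$ and $\mu_n$ $(n\in\mathbb N)$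 be admissible measures such that $\mu_n\rightharpoonup\mu$ weakly and $\operatorname{supp}\mu\subseteq\operatorname{supp}\mu_n$ for all $n$. Let $\pi_n:(C[0,1])_\mu^b\to(C[0,1])_{\mu_n}^b$ send $f$ to the $L^2([0,1],\mu_n)$-class of the continuous representative of $f$ that is linear on every interval of $[0,1]\setminus\operatorname{supp}\mu$, and let $R_{\lambda,n}^b=(\lambda-\Delta_{\mu_n}^b)^{-1}$. Then, for $b\in\{N,D\}$ and every $\lambda>0$, the operators $\lambda-\Delta_\mu^b$ and $\lambda-\Delta_{\mu_n}^b$ are bijections of their domains onto $L^2([0,1],\mu)$ and $L^2([0,1],\mu_n)$, respectively (so the resolvents are well defined), and for every $f\in(C[0,1])_\mu^b$ $$\lim_{n\to\infty}\bigl\|R_{\lambda,n}^b\,\pi_n f-\pi_n R_\lambda^b f\bigr\|_\infty=0 .$$ -/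

import Mathlib

open MeasureTheory Set Filter Topology

namespace KreinFeller

/-- The measures under consideration: non-atomic Borel probability measures on `[0,1]`
(viewed as Borel measures on `ℝ` carried by `[0,1]`) whose support contains `0` and `1`. -/
class Admissible (μ : Measure ℝ) : Prop extends IsProbabilityMeasure μ, NullSingletonClass μ where
  null_compl : μ (Icc 0 1)ᶜ = 0
  zero_mem : (0 : ℝ) ∈ μ.support
  one_mem : (1 : ℝ) ∈ μ.support

/-- The two boundary conditions. -/
inductive BC
  | neumann
  | dirichlet

/-! ### Facts on admissible measures used by the definitions -/

section Aux

variable {μ : Measure ℝ} [Admissible μ]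

theorem support_subset : μ.support ⊆ Icc 0 1 :=
  Measure.support_subset_of_isClosed isClosed_Icc
    (mem_ae_iff.2 (Admissible.null_compl (μ := μ)))

theorem restrict_Icc : μ.restrict (Icc 0 1) = μ :=
  Measure.restrict_eq_self_of_ae_mem (mem_ae_iff.2 (Admissible.null_compl (μ := μ)))

theorem memLp_of_continuousOn {g : ℝ → ℝ} (hg : ContinuousOn g (Icc 0 1)) : MemLp g 2 μ := by
  obtain ⟨C, hC⟩ := isCompact_Icc.exists_bound_of_continuousOn hg
  have h1 : AEStronglyMeasurable g μ := by
    have := hg.aestronglyMeasurable (μ := μ) measurableSet_Icc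
    rwa [restrict_Icc] at this
  refine MemLp.of_bound h1 C ?_
  have : ∀ᵐ x ∂μ, x ∈ Icc (0 : ℝ) 1 := mem_ae_iff.2 (Admissible.null_compl (μ := μ))
  filter_upwards [this] with x hx using hC x hx

theorem exists_mem_support_ne {x : ℝ} (hx : x ∈ μ.support) {U : Set ℝ} (hU : U ∈ 𝓝 x) :
    ∃ y ∈ U, y ≠ x ∧ y ∈ μ.support := by
  have h0 : 0 < μ (U \ {x}) := by
    rw [measure_sdiff_null (measure_singleton x)]
    exact (Measure.mem_support_iff_forall x).1 hx U hU
  obtain ⟨y, hy, hy'⟩ := Measure.nonempty_inter_support_of_pos h0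
  exact ⟨y, hy.1, hy.2, hy'⟩

theorem eq_zero_on_support {f : ℝ → ℝ} (hf : ContinuousOn f (Icc 0 1)) (h0 : f =ᵐ[μ] 0)
    {x : ℝ} (hx : x ∈ μ.support) : f x = 0 := by
  by_contra hne
  have h1 : {y | f y ≠ 0} ∈ 𝓝[Icc 0 1] x :=
    (hf x (support_subset hx)) (isOpen_ne.mem_nhds hne)
  obtain ⟨U, hU, hUs⟩ := mem_nhdsWithin_iff_exists_mem_nhds_inter.1 h1
  have h2 := (Measure.mem_support_iff_forall x).1 hx U hU
  have h3 : μ U ≤ μ ((Icc 0 1)ᶜ ∪ {y | f y ≠ 0}) := by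
    refine measure_mono fun y hy => ?_
    by_cases hyI : y ∈ Icc (0 : ℝ) 1
    · exact Or.inr (hUs ⟨hy, hyI⟩)
    · exact Or.inl hyI
  have h4 : μ ((Icc 0 1)ᶜ ∪ {y | f y ≠ 0}) = 0 :=
    measure_union_null (Admissible.null_compl) (ae_iff.1 h0)
  exact absurd (h3.trans h4.le) (not_le.2 h2)

end Aux

/-! ### The spaces of continuous functions -/

/-- The admissible boundary values of a continuous representative: none for Neumann, `g 0 = g 1 = 0`
for Dirichlet boundary conditions. -/
def BC.Vanish : BC → (ℝ → ℝ) → Prop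
  | .neumann, _ => True
  | .dirichlet, g => g 0 = 0 ∧ g 1 = 0

/-- The space `(C[0,1])_μ^b` of all `L²(μ)`-classes possessing a continuous representative on
`[0,1]` (with zero boundary values in the Dirichlet case). -/
def CSpace (μ : Measure ℝ) (b : BC) : Submodule ℝ (Lp ℝ 2 μ) where
  carrier := {f | ∃ g : ℝ → ℝ, ContinuousOn g (Icc 0 1) ∧ b.Vanish g ∧ f =ᵐ[μ] g}
  zero_mem' := ⟨fun _ => 0, continuousOn_const, by cases b <;> simp [BC.Vanish],
    Lp.coeFn_zero ℝ 2 μ⟩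
  add_mem' := by
    rintro f₁ f₂ ⟨g₁, hc₁, hb₁, h₁⟩ ⟨g₂, hc₂, hb₂, h₂⟩
    refine ⟨g₁ + g₂, hc₁.add hc₂, ?_, (Lp.coeFn_add f₁ f₂).trans (h₁.add h₂)⟩
    cases b <;> simp_all [BC.Vanish]
  smul_mem' := by
    rintro c f ⟨g, hc, hb, h⟩
    refine ⟨c • g, hc.const_smul c, ?_, (Lp.coeFn_smul c f).trans (h.const_smul c)⟩
    cases b <;> simp_all [BC.Vanish]

/-- `gapLinear K g` agrees with `g` on the closed set `K` and interpolates `g` linearly on every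
gap of `K`: if `l` is the last point of `K` before `x` and `r` the first one after `x`, its value
at `x` is `g l + (x - l) / (r - l) * (g r - g l)` (which is `g x` when `x ∈ K`, as then
`l = r = x`). -/
noncomputable def gapLinear (K : Set ℝ) (g : ℝ → ℝ) (x : ℝ) : ℝ :=
  g (sSup (K ∩ Iic x)) + (x - sSup (K ∩ Iic x)) / (sInf (K ∩ Ici x) - sSup (K ∩ Iic x)) *
    (g (sInf (K ∩ Ici x)) - g (sSup (K ∩ Iic x)))

theorem gapLinear_of_mem {K : Set ℝ} {g : ℝ → ℝ} {x : ℝ} (hx : x ∈ K) :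
    gapLinear K g x = g x := by
  have h1 : IsGreatest (K ∩ Iic x) x := ⟨⟨hx, le_refl x⟩, fun y hy => hy.2⟩
  simp [gapLinear, h1.csSup_eq]

theorem gapLinear_of_gap {K : Set ℝ} {g : ℝ → ℝ} {l r x : ℝ} (hl : l ∈ K) (hr : r ∈ K)
    (hgap : ∀ y ∈ K, y ≤ l ∨ r ≤ y) (hx : x ∈ Icc l r) :
    gapLinear K g x = g l + (x - l) / (r - l) * (g r - g l) := by
  rcases eq_or_lt_of_le hx.1 with rfl | hlx
  · simp [gapLinear_of_mem hl]
  rcases eq_or_lt_of_le hx.2 with rfl | hxr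
  · rw [gapLinear_of_mem hr, div_self (sub_ne_zero.2 hlx.ne')]; ring
  have h1 : IsGreatest (K ∩ Iic x) l := ⟨⟨hl, hlx.le⟩, fun y hy =>
    (hgap y hy.1).resolve_right (not_le.2 (lt_of_le_of_lt hy.2 hxr))⟩
  have h2 : IsLeast (K ∩ Ici x) r := ⟨⟨hr, hxr.le⟩, fun y hy =>
    (hgap y hy.1).resolve_left (not_le.2 (lt_of_lt_of_le hlx hy.2))⟩
  simp [gapLinear, h1.csSup_eq, h2.csInf_eq]

theorem exists_gap {K : Set ℝ} (hK : IsClosed K) {p q x : ℝ} (hp : p ∈ K) (hq : q ∈ K)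
    (hx : x ∈ Icc p q) : ∃ l ∈ K, ∃ r ∈ K, (∀ y ∈ K, y ≤ l ∨ r ≤ y) ∧
      x ∈ Icc l r ∧ p ≤ l ∧ r ≤ q := by
  have hb1 : BddAbove (K ∩ Iic x) := ⟨x, fun y hy => hy.2⟩
  have hb2 : BddBelow (K ∩ Ici x) := ⟨x, fun y hy => hy.2⟩
  have h1 := (hK.inter isClosed_Iic).csSup_mem ⟨p, hp, hx.1⟩ hb1
  have h2 := (hK.inter isClosed_Ici).csInf_mem ⟨q, hq, hx.2⟩ hb2
  refine ⟨_, h1.1, _, h2.1, fun y hy => ?_, ⟨h1.2, h2.2⟩,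
    le_csSup hb1 ⟨hp, hx.1⟩, csInf_le hb2 ⟨hq, hx.2⟩⟩
  rcases le_total y x with h | h
  · exact Or.inl (le_csSup hb1 ⟨hy, h⟩)
  · exact Or.inr (csInf_le hb2 ⟨hy, h⟩)

theorem continuousOn_gapLinear_gap {K : Set ℝ} {g : ℝ → ℝ} {l r : ℝ} (hl : l ∈ K) (hr : r ∈ K)
    (hgap : ∀ y ∈ K, y ≤ l ∨ r ≤ y) : ContinuousOn (gapLinear K g) (Icc l r) := by
  have : ContinuousOn (fun x : ℝ => g l + (x - l) / (r - l) * (g r - g l)) (Icc l r) := by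
    fun_prop
  exact this.congr fun x hx => gapLinear_of_gap hl hr hgap hx

theorem abs_gapLinear_sub_lt {K : Set ℝ} (hK : IsClosed K) {g : ℝ → ℝ} {p q x c ε : ℝ}
    (hp : p ∈ K) (hq : q ∈ K) (hx : x ∈ Icc p q) (hg : ∀ y ∈ K ∩ Icc p q, |g y - c| < ε) :
    |gapLinear K g x - c| < ε := by
  obtain ⟨l, hl, r, hr, hgap, hxlr, hpl, hrq⟩ := exists_gap hK hp hq hx
  rw [gapLinear_of_gap hl hr hgap hxlr]
  have h1 := hg l ⟨hl, hpl, (hxlr.1.trans hxlr.2).trans hrq⟩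
  have h2 := hg r ⟨hr, hpl.trans (hxlr.1.trans hxlr.2), hrq⟩
  set t := (x - l) / (r - l) with ht
  have ht0 : 0 ≤ t := div_nonneg (by linarith [hxlr.1]) (by linarith [hxlr.1, hxlr.2])
  have ht1 : t ≤ 1 := div_le_one_of_le₀ (by linarith [hxlr.2]) (by linarith [hxlr.1, hxlr.2])
  refine lt_of_le_of_lt ?_ (max_lt h1 h2)
  have k1 := abs_le.1 (le_max_left |g l - c| |g r - c|)
  have k2 := abs_le.1 (le_max_right |g l - c| |g r - c|)
  set M := max |g l - c| |g r - c|
  rw [abs_le]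
  constructor <;> nlinarith [mul_nonneg ht0 (sub_nonneg.2 k2.1), mul_nonneg ht0 (sub_nonneg.2 k2.2),
    mul_nonneg (sub_nonneg.2 ht1) (sub_nonneg.2 k1.1),
    mul_nonneg (sub_nonneg.2 ht1) (sub_nonneg.2 k1.2)]

theorem continuousOn_gapLinear {K : Set ℝ} (hK : IsClosed K) {g : ℝ → ℝ} {p q : ℝ}
    (hp : p ∈ K) (hq : q ∈ K) (hg : ContinuousOn g K) :
    ContinuousOn (gapLinear K g) (Icc p q) := by
  intro x₀ hx₀
  by_cases hxK : x₀ ∈ K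
  · have hleft : ContinuousWithinAt (gapLinear K g) (Icc p x₀) x₀ := by
      rcases eq_or_lt_of_le hx₀.1 with rfl | hlt
      · simp
      by_cases hacc : ∀ δ > 0, ∃ y ∈ K, x₀ - δ < y ∧ y < x₀
      · rw [Metric.continuousWithinAt_iff]
        intro ε hε
        obtain ⟨δ, hδ, H⟩ := Metric.continuousWithinAt_iff.1 (hg x₀ hxK) ε hε
        obtain ⟨y, hy, hy1, hy2⟩ := hacc δ hδ
        refine ⟨x₀ - y, by linarith, fun {x} hx hxd => ?_⟩
        rw [Real.dist_eq] at hxd ⊢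
        rw [gapLinear_of_mem hxK]
        refine abs_gapLinear_sub_lt hK hy hxK ⟨by linarith [(abs_lt.1 hxd).1], hx.2⟩ ?_
        rintro z ⟨hz, hz1, hz2⟩
        have := H hz (by rw [Real.dist_eq, abs_lt]; constructor <;> linarith)
        rwa [Real.dist_eq] at this
      · push Not at hacc
        obtain ⟨δ, hδ, H⟩ := hacc
        have hm0 : 0 < min δ (x₀ - p) := lt_min hδ (by linarith)
        have hm1 := min_le_left δ (x₀ - p)
        have hm2 := min_le_right δ (x₀ - p)
        set m := min δ (x₀ - p)
        obtain ⟨l, hl, r, hr, hgap, hxlr, hpl, hrq⟩ := exists_gap hK hp hxK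
          (x := x₀ - m / 2) ⟨by linarith, by linarith⟩
        have hrx : r = x₀ := le_antisymm hrq (H r hr (by linarith [hxlr.2]))
        subst hrx
        have hc := continuousOn_gapLinear_gap (g := g) hl hr hgap r ⟨by linarith [hxlr.1], le_rfl⟩
        refine hc.mono_of_mem_nhdsWithin ?_
        refine mem_nhdsWithin.2 ⟨Ioi l, isOpen_Ioi, mem_Ioi.2 (by linarith [hxlr.1]), ?_⟩
        exact fun y hy => ⟨le_of_lt hy.1, hy.2.2⟩
    have hright : ContinuousWithinAt (gapLinear K g) (Icc x₀ q) x₀ := by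
      rcases eq_or_lt_of_le hx₀.2 with rfl | hlt
      · simp
      by_cases hacc : ∀ δ > 0, ∃ y ∈ K, x₀ < y ∧ y < x₀ + δ
      · rw [Metric.continuousWithinAt_iff]
        intro ε hε
        obtain ⟨δ, hδ, H⟩ := Metric.continuousWithinAt_iff.1 (hg x₀ hxK) ε hε
        obtain ⟨y, hy, hy1, hy2⟩ := hacc δ hδ
        refine ⟨y - x₀, by linarith, fun {x} hx hxd => ?_⟩
        rw [Real.dist_eq] at hxd ⊢
        rw [gapLinear_of_mem hxK]
        refine abs_gapLinear_sub_lt hK hxK hy ⟨hx.1, by linarith [(abs_lt.1 hxd).2]⟩ ?_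
        rintro z ⟨hz, hz1, hz2⟩
        have := H hz (by rw [Real.dist_eq, abs_lt]; constructor <;> linarith)
        rwa [Real.dist_eq] at this
      · push Not at hacc
        obtain ⟨δ, hδ, H⟩ := hacc
        have hm0 : 0 < min δ (q - x₀) := lt_min hδ (by linarith)
        have hm1 := min_le_left δ (q - x₀)
        have hm2 := min_le_right δ (q - x₀)
        set m := min δ (q - x₀)
        obtain ⟨l, hl, r, hr, hgap, hxlr, hpl, hrq⟩ := exists_gap hK hxK hq
          (x := x₀ + m / 2) ⟨by linarith, by linarith⟩
        have hlx : x₀ = l := by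
          refine le_antisymm hpl (not_lt.1 fun h => ?_)
          linarith [H l hl h, hxlr.1]
        subst hlx
        have hc := continuousOn_gapLinear_gap (g := g) hl hr hgap x₀ ⟨le_rfl, by linarith [hxlr.2]⟩
        refine hc.mono_of_mem_nhdsWithin ?_
        refine mem_nhdsWithin.2 ⟨Iio r, isOpen_Iio, mem_Iio.2 (by linarith [hxlr.2]), ?_⟩
        exact fun y hy => ⟨hy.2.1, le_of_lt hy.1⟩
    have := hleft.union hright
    rwa [Icc_union_Icc_eq_Icc hx₀.1 hx₀.2] at this
  · obtain ⟨l, hl, r, hr, hgap, hxlr, -, -⟩ := exists_gap hK hp hq hx₀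
    have h1 : l < x₀ := lt_of_le_of_ne hxlr.1 fun h => hxK (h ▸ hl)
    have h2 : x₀ < r := lt_of_le_of_ne hxlr.2 fun h => hxK (h ▸ hr)
    exact ((continuousOn_gapLinear_gap hl hr hgap).continuousAt
      (Icc_mem_nhds h1 h2)).continuousWithinAt

/-- The continuous representative of an element of `(C[0,1])_μ^b` that is linear on every interval
of `[0,1] ∖ supp μ`. Pointwise evaluation always refers to this representative. -/
noncomputable def rep {μ : Measure ℝ} {b : BC} (f : CSpace μ b) : ℝ → ℝ :=
  gapLinear μ.support f.2.choose

theorem coe_ae_eq_rep {μ : Measure ℝ} {b : BC} (f : CSpace μ b) : f.1 =ᵐ[μ] rep f := by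
  filter_upwards [f.2.choose_spec.2.2, Measure.support_mem_ae (μ := μ)] with x hx hxs
  rw [hx]
  exact (gapLinear_of_mem hxs).symm

section Rep

variable {μ : Measure ℝ} [Admissible μ] {b : BC}

theorem continuousOn_rep (f : CSpace μ b) : ContinuousOn (rep f) (Icc 0 1) :=
  continuousOn_gapLinear Measure.isClosed_support Admissible.zero_mem Admissible.one_mem
    (f.2.choose_spec.1.mono support_subset)

theorem rep_vanish (f : CSpace μ b) : b.Vanish (rep f) := by
  have h := f.2.choose_spec.2.1
  cases b
  · trivial
  · exact ⟨(gapLinear_of_mem (Admissible.zero_mem (μ := μ))).trans h.1,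
      (gapLinear_of_mem (Admissible.one_mem (μ := μ))).trans h.2⟩

end Rep

/-- The norm of `(C[0,1])_μ^b`, the supremum of `|f|` over `supp μ`. -/
noncomputable def supNorm {μ : Measure ℝ} {b : BC} (f : CSpace μ b) : ℝ :=
  ⨆ x : μ.support, |rep f x|

/-- The map `(C[0,1])_μ^b → (C[0,1])_ν^b` which sends `f` to the `L²(ν)`-class of the continuous
representative of `f` that is linear on every interval of `[0,1] ∖ supp μ`. -/
noncomputable def embed {μ : Measure ℝ} [Admissible μ] (ν : Measure ℝ) [Admissible ν] {b : BC}
    (f : CSpace μ b) : CSpace ν b :=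
  ⟨(memLp_of_continuousOn (continuousOn_rep f)).toLp (rep f),
    rep f, continuousOn_rep f, rep_vanish f, MemLp.coeFn_toLp _⟩

/-! ### The Krein-Feller operators -/

/-- `f ∈ C¹([0,1])` and `f'` has the `μ`-derivative `v`, that is,
`f'(x) = f'(0) + ∫₀ˣ v dμ` for all `x ∈ [0,1]` (one-sided derivatives at the end points). -/
def HasMuLaplacian (μ : Measure ℝ) (f v : ℝ → ℝ) : Prop :=
  ContDiffOn ℝ 1 f (Icc 0 1) ∧ ∀ x ∈ Icc (0 : ℝ) 1,
    derivWithin f (Icc 0 1) x = derivWithin f (Icc 0 1) 0 + ∫ y in (0 : ℝ)..x, v y ∂μ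

/-- The boundary conditions: `f'(0) = f'(1) = 0` (Neumann), `f(0) = f(1) = 0` (Dirichlet). -/
def BC.Holds : BC → (ℝ → ℝ) → Prop
  | .neumann, f => derivWithin f (Icc 0 1) 0 = 0 ∧ derivWithin f (Icc 0 1) 1 = 0
  | .dirichlet, f => f 0 = 0 ∧ f 1 = 0

theorem eq_zero_of_setIntegral_Iic {μ : Measure ℝ} [IsProbabilityMeasure μ] {v : ℝ → ℝ}
    (hv : Integrable v μ) (h : ∀ x, ∫ y in Iic x, v y ∂μ = 0) (huniv : ∫ y, v y ∂μ = 0) :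
    v =ᵐ[μ] 0 := by
  refine hv.ae_eq_zero_of_forall_setIntegral_eq_zero fun s hs _ => ?_
  induction s, hs using MeasurableSpace.induction_on_inter (borel_eq_generateFrom_Iic ℝ)
    isPiSystem_Iic with
  | empty => simp
  | basic t ht => obtain ⟨x, rfl⟩ := ht; exact h x
  | compl t ht ih =>
    have := integral_add_compl ht hv
    rw [ih (measure_lt_top _ _), huniv] at this
    linarith
  | iUnion f hd hm ih =>
    rw [integral_iUnion hm hd hv.integrableOn]
    simp [fun i => ih i (measure_lt_top _ _)]

/-- The `μ`-Laplacian of a function depends only on its `L²(μ)`-class. -/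
theorem HasMuLaplacian.eq_zero {μ : Measure ℝ} [Admissible μ] {f v : ℝ → ℝ}
    (h : HasMuLaplacian μ f v) (hv : Integrable v μ) (hf : f =ᵐ[μ] 0) : v =ᵐ[μ] 0 := by
  have hcont := h.1.continuousOn
  have hsupp : ∀ x ∈ μ.support, derivWithin f (Icc 0 1) x = 0 := by
    intro x hx
    have hd := (h.1.differentiableOn one_ne_zero x (support_subset hx)).hasDerivWithinAt
    rw [hasDerivWithinAt_iff_tendsto_slope] at hd
    by_contra hne
    have hev := hd.eventually_ne hne
    obtain ⟨U, hU, hUs⟩ := mem_nhdsWithin_iff_exists_mem_nhds_inter.1 hev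
    obtain ⟨y, hyU, hyx, hys⟩ := exists_mem_support_ne hx hU
    refine hUs ⟨hyU, support_subset hys, hyx⟩ ?_
    simp [slope, eq_zero_on_support hcont hf hx, eq_zero_on_support hcont hf hys]
  have hI : ∀ x ∈ Icc (0 : ℝ) 1, ∫ y in (0 : ℝ)..x, v y ∂μ = 0 := by
    intro x hx
    obtain ⟨l, hl, r, hr, hgap, hxlr, -, -⟩ := exists_gap (Measure.isClosed_support (μ := μ))
      Admissible.zero_mem Admissible.one_mem hx
    have h0 := hsupp 0 Admissible.zero_mem
    have h1 : ∫ y in (0 : ℝ)..l, v y ∂μ = 0 := by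
      have := h.2 l (support_subset hl)
      rw [hsupp l hl, h0] at this
      linarith
    have h2 : ∫ y in l..x, v y ∂μ = 0 := by
      rw [intervalIntegral.integral_of_le hxlr.1, integral_Ioc_eq_integral_Ioo]
      refine setIntegral_measure_zero _ (measure_mono_null (t := μ.supportᶜ) ?_
        Measure.measure_compl_support)
      intro y hy hys
      rcases hgap y hys with h | h
      · exact absurd h (not_le.2 hy.1)
      · exact absurd (hy.2.trans_le hxlr.2) (not_lt.2 h)
    rw [← intervalIntegral.integral_add_adjacent_intervals (b := l)
      hv.intervalIntegrable hv.intervalIntegrable, h1, h2, add_zero]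
  have hIic : ∀ x, ∫ y in Iic x, v y ∂μ = ∫ y in (0 : ℝ)..(max 0 (min x 1)), v y ∂μ := by
    intro x
    rw [intervalIntegral.integral_of_le (le_max_left _ _), ← integral_Icc_eq_integral_Ioc]
    rcases lt_or_ge x 0 with hx | hx
    · have e1 : ∫ y in Iic x, v y ∂μ = 0 := setIntegral_measure_zero _
        (measure_mono_null (t := (Icc 0 1)ᶜ)
          (fun y (hy : y ≤ x) (hyI : y ∈ Icc (0 : ℝ) 1) =>
            absurd hyI.1 (not_le.2 (hy.trans_lt hx))) Admissible.null_compl)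
      rw [e1, max_eq_left ((min_le_left _ _).trans hx.le)]
      simp
    · rw [max_eq_right (le_min hx zero_le_one)]
      refine setIntegral_congr_set ?_
      have : ∀ᵐ y ∂μ, y ∈ Icc (0 : ℝ) 1 := mem_ae_iff.2 (Admissible.null_compl (μ := μ))
      filter_upwards [this] with y hy
      refine propext ⟨fun h => ⟨hy.1, le_min h hy.2⟩, fun h => h.2.trans (min_le_left _ _)⟩
  have hz : ∀ x, ∫ y in Iic x, v y ∂μ = 0 := fun x => by
    rw [hIic]
    exact hI _ ⟨le_max_left _ _, max_le zero_le_one (min_le_right _ _)⟩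
  refine eq_zero_of_setIntegral_Iic hv hz ?_
  rw [← hz 1]
  refine (setIntegral_eq_integral_of_ae_compl_eq_zero ?_).symm
  have : ∀ᵐ y ∂μ, y ∈ Icc (0 : ℝ) 1 := mem_ae_iff.2 (Admissible.null_compl (μ := μ))
  filter_upwards [this] with y hy hn using absurd hy.2 hn

theorem integrable_coe {μ : Measure ℝ} [Admissible μ] (v : Lp ℝ 2 μ) : Integrable v μ :=
  (Lp.memLp v).integrable (by norm_num)

/-- The graph of `Δ_μ^b`: all pairs `(u, v)` in `L²(μ) × L²(μ)` such that `u` has a representative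
`f ∈ C¹([0,1])` which satisfies the boundary conditions and whose derivative has the
`μ`-derivative `v`. -/
def laplacianGraph (μ : Measure ℝ) [Admissible μ] (b : BC) :
    Submodule ℝ (Lp ℝ 2 μ × Lp ℝ 2 μ) where
  carrier := {p | ∃ f : ℝ → ℝ, HasMuLaplacian μ f p.2 ∧ b.Holds f ∧ p.1 =ᵐ[μ] f}
  zero_mem' := by
    refine ⟨fun _ => 0, ⟨contDiffOn_const, fun x hx => ?_⟩, ?_, Lp.coeFn_zero ℝ 2 μ⟩
    · simp
    · cases b <;> simp [BC.Holds]
  add_mem' := by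
    rintro ⟨u₁, v₁⟩ ⟨u₂, v₂⟩ ⟨f₁, ⟨hc₁, hd₁⟩, hb₁, h₁⟩ ⟨f₂, ⟨hc₂, hd₂⟩, hb₂, h₂⟩
    have hder : ∀ x ∈ Icc (0 : ℝ) 1, derivWithin (f₁ + f₂) (Icc 0 1) x =
        derivWithin f₁ (Icc 0 1) x + derivWithin f₂ (Icc 0 1) x := fun x hx =>
      derivWithin_add (hc₁.differentiableOn one_ne_zero x hx)
        (hc₂.differentiableOn one_ne_zero x hx)
    have h0 : (0 : ℝ) ∈ Icc (0 : ℝ) 1 := by simp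
    have h1 : (1 : ℝ) ∈ Icc (0 : ℝ) 1 := by simp
    refine ⟨f₁ + f₂, ⟨hc₁.add hc₂, fun x hx => ?_⟩, ?_, (Lp.coeFn_add u₁ u₂).trans (h₁.add h₂)⟩
    · have : ∫ y in (0 : ℝ)..x, (v₁ + v₂ : Lp ℝ 2 μ) y ∂μ =
          ∫ y in (0 : ℝ)..x, v₁ y ∂μ + ∫ y in (0 : ℝ)..x, v₂ y ∂μ := by
        rw [← intervalIntegral.integral_add (integrable_coe v₁).intervalIntegrable
          (integrable_coe v₂).intervalIntegrable]
        refine intervalIntegral.integral_congr_ae ?_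
        filter_upwards [Lp.coeFn_add v₁ v₂] with y hy _ using hy
      rw [hder x hx, hder 0 h0, hd₁ x hx, hd₂ x hx]
      refine Eq.trans ?_ (congrArg _ this.symm)
      ring
    · cases b
      · exact ⟨by rw [hder 0 h0, hb₁.1, hb₂.1, add_zero], by rw [hder 1 h1, hb₁.2, hb₂.2, add_zero]⟩
      · exact ⟨by simp [hb₁.1, hb₂.1], by simp [hb₁.2, hb₂.2]⟩
  smul_mem' := by
    rintro c ⟨u, v⟩ ⟨f, ⟨hc, hd⟩, hb, h⟩
    have hder : ∀ x ∈ Icc (0 : ℝ) 1, derivWithin (c • f) (Icc 0 1) x =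
        c * derivWithin f (Icc 0 1) x := fun x hx =>
      derivWithin_const_smul c (hc.differentiableOn one_ne_zero x hx)
    have h0 : (0 : ℝ) ∈ Icc (0 : ℝ) 1 := by simp
    have h1 : (1 : ℝ) ∈ Icc (0 : ℝ) 1 := by simp
    refine ⟨c • f, ⟨hc.const_smul c, fun x hx => ?_⟩, ?_,
      (Lp.coeFn_smul c u).trans (h.const_smul c)⟩
    · have : ∫ y in (0 : ℝ)..x, (c • v : Lp ℝ 2 μ) y ∂μ = c * ∫ y in (0 : ℝ)..x, v y ∂μ := by
        rw [← intervalIntegral.integral_const_mul]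
        refine intervalIntegral.integral_congr_ae ?_
        filter_upwards [Lp.coeFn_smul c v] with y hy _ using hy
      rw [hder x hx, hder 0 h0, hd x hx]
      refine Eq.trans ?_ (congrArg _ this.symm)
      ring
    · cases b
      · exact ⟨by rw [hder 0 h0, hb.1, mul_zero], by rw [hder 1 h1, hb.2, mul_zero]⟩
      · exact ⟨by simp [hb.1], by simp [hb.2]⟩

/-- The Krein-Feller operator `Δ_μ^b` as an unbounded operator on `L²(μ)`. -/
noncomputable def laplacian (μ : Measure ℝ) [Admissible μ] (b : BC) :
    Lp ℝ 2 μ →ₗ.[ℝ] Lp ℝ 2 μ :=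
  (laplacianGraph μ b).toLinearPMap

theorem laplacian_graph (μ : Measure ℝ) [Admissible μ] (b : BC) :
    (laplacian μ b).graph = laplacianGraph μ b := by
  refine Submodule.toLinearPMap_graph_eq _ ?_
  rintro ⟨u, v⟩ ⟨f, hf, -, h⟩ hu
  refine Lp.eq_zero_iff_ae_eq_zero.2 (hf.eq_zero (integrable_coe v) (h.symm.trans ?_))
  simp only at hu
  rw [hu]
  exact Lp.coeFn_zero ℝ 2 μ

theorem laplacian_domain_le (μ : Measure ℝ) [Admissible μ] (b : BC) :
    (laplacian μ b).domain ≤ CSpace μ b := by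
  rintro _ ⟨⟨u, v⟩, ⟨f, hf, hb, h⟩, rfl⟩
  refine ⟨f, hf.1.continuousOn, ?_, h⟩
  cases b
  · trivial
  · exact hb

/-- The operator `c - Δ_μ^b` on the domain of `Δ_μ^b`. -/
noncomputable def shifted (μ : Measure ℝ) [Admissible μ] (b : BC) (c : ℝ) :
    (laplacian μ b).domain → Lp ℝ 2 μ :=
  fun u => c • (u : Lp ℝ 2 μ) - laplacian μ b u

/-- The resolvent operator `R_c^b = (c - Δ_μ^b)⁻¹` on `L²(μ)` (meaningful when `c - Δ_μ^b` is a
bijection of the domain of `Δ_μ^b` onto `L²(μ)`). -/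
noncomputable def resolvent (μ : Measure ℝ) [Admissible μ] (b : BC) (c : ℝ) :
    Lp ℝ 2 μ → (laplacian μ b).domain :=
  Function.invFun (shifted μ b c)

/-- The resolvent operator applied to, and with values in, the space `(C[0,1])_μ^b`. -/
noncomputable def resolventC (μ : Measure ℝ) [Admissible μ] (b : BC) (c : ℝ) (f : CSpace μ b) :
    CSpace μ b :=
  Submodule.inclusion (laplacian_domain_le μ b) (resolvent μ b c f)

/-- The measure as a point of the space of Borel probability measures on `ℝ`, which carries the
topology of weak convergence. -/
def toProb (μ : Measure ℝ) [Admissible μ] : ProbabilityMeasure ℝ := ⟨μ, inferInstance⟩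

end KreinFeller

namespace KreinFeller

/-! The resolvent equation becomes an integral equation on all of `[0,1]` in which the measure
enters only as an integrator. Integrating twice, `(c - Δ_ν) u = g` says `u = s q + V_ν (c u - g)`,
where `q` is `1` (Neumann) or `x` (Dirichlet), `s` is the free initial value, and one scalar
condition at `1` fixes `s` (`mem_laplacianGraph_iff`).

The core is a stability estimate whose constant depends on `c` alone
(`BC.abs_le_stabilityConst_mul`): if `d = s q + c V_ν d` up to an error `ε` and the end value of `d`
is at most `ε`, then `|d| ≤ C(c) ε`. Gronwall together with positivity of the kernel gives `d ≥ s q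
- C ε` for `s ≥ 0`, so a large `s` would force a large end value; once `s` is bounded on both sides,
Gronwall bounds `d`. With `ε = 0` this is injectivity of `c - Δ_ν`; surjectivity follows by
shooting.

For convergence, the difference of the solutions for `μ_n` and `μ` satisfies the `μ_n`-equation with
error `(V_{μ_n} - V_μ)(c u - g)`. This tends to `0` uniformly, by weak convergence and
equicontinuity of the functions `V_ν G` for fixed `G`. Solutions for `μ` are affine on the gaps of
`supp μ` when `g` is replaced by any representative (`volterra_gap`), so `π_n R_λ f` is represented
by `u` itself. -/

/-- The Volterra operator `u ↦ (x ↦ ∫ (x - y)⁺ u(y) dν(y))` which inverts `f ↦ (f')^ν` under zero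
initial conditions. -/
noncomputable def volterra (ν : Measure ℝ) (u : ℝ → ℝ) (x : ℝ) : ℝ :=
  ∫ y, max (x - y) 0 * u y ∂ν

/-! ### The Volterra operator and its relation to the `ν`-Laplacian. -/

section Volterra

variable {ν : Measure ℝ}

theorem volterra_const_mul (c : ℝ) (u : ℝ → ℝ) (x : ℝ) :
    volterra ν (fun y => c * u y) x = c * volterra ν u x := by
  unfold volterra
  rw [← integral_const_mul]
  simp only [mul_left_comm]

theorem volterra_neg (u : ℝ → ℝ) (x : ℝ) :
    volterra ν (fun y => - u y) x = - volterra ν u x := by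
  simpa using volterra_const_mul (ν := ν) (-1) u x

theorem volterra_congr_ae {u v : ℝ → ℝ} (h : u =ᵐ[ν] v) (x : ℝ) :
    volterra ν u x = volterra ν v x := by
  refine integral_congr_ae ?_
  filter_upwards [h] with y hy
  rw [hy]

theorem abs_kernel_sub_le (x x' y : ℝ) : |max (x - y) 0 - max (x' - y) 0| ≤ |x - x'| := by
  simpa using abs_max_sub_max_le_abs (x - y) (x' - y) 0

variable [Admissible ν]

theorem ae_mem_Icc : ∀ᵐ x ∂ν, x ∈ Icc (0 : ℝ) 1 :=
  mem_ae_iff.2 (Admissible.null_compl (μ := ν))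

theorem integrable_of_continuousOn {g : ℝ → ℝ} (hg : ContinuousOn g (Icc 0 1)) :
    Integrable g ν :=
  (memLp_of_continuousOn hg).integrable (by norm_num)

theorem integrable_kernel_mul {u : ℝ → ℝ} (hu : Integrable u ν) (x : ℝ) :
    Integrable (fun y => max (x - y) 0 * u y) ν := by
  refine hu.bdd_mul (c := |x| + 1) (by fun_prop) ?_
  filter_upwards [ae_mem_Icc (ν := ν)] with y hy
  rw [Real.norm_eq_abs, abs_of_nonneg (le_max_right _ _)]
  refine max_le ?_ (by positivity)
  linarith [le_abs_self x, hy.1]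

theorem volterra_add {u v : ℝ → ℝ} (hu : Integrable u ν) (hv : Integrable v ν) (x : ℝ) :
    volterra ν (fun y => u y + v y) x = volterra ν u x + volterra ν v x := by
  unfold volterra
  rw [← integral_add (integrable_kernel_mul hu x) (integrable_kernel_mul hv x)]
  simp only [mul_add]

theorem volterra_sub {u v : ℝ → ℝ} (hu : Integrable u ν) (hv : Integrable v ν) (x : ℝ) :
    volterra ν (fun y => u y - v y) x = volterra ν u x - volterra ν v x := by
  unfold volterra
  rw [← integral_sub (integrable_kernel_mul hu x) (integrable_kernel_mul hv x)]
  simp only [mul_sub]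

theorem volterra_nonneg {u : ℝ → ℝ} (hu : ∀ y ∈ Icc (0 : ℝ) 1, 0 ≤ u y) (x : ℝ) :
    0 ≤ volterra ν u x := by
  refine integral_nonneg_of_ae ?_
  filter_upwards [ae_mem_Icc (ν := ν)] with y hy
  exact mul_nonneg (le_max_right _ _) (hu y hy)

/-- The kernel takes values in `[0,1]` on the unit square and `ν` is a probability measure, so a
nonpositive lower bound survives. -/
theorem neg_le_volterra {u : ℝ → ℝ} (hi : Integrable u ν) {m : ℝ} (hm : 0 ≤ m)
    (hu : ∀ y ∈ Icc (0 : ℝ) 1, -m ≤ u y) {x : ℝ} (hx : x ∈ Icc (0 : ℝ) 1) :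
    -m ≤ volterra ν u x := by
  have h : ∫ _, -m ∂ν ≤ volterra ν u x := by
    refine integral_mono_ae (integrable_const _) (integrable_kernel_mul hi x) ?_
    filter_upwards [ae_mem_Icc (ν := ν)] with y hy
    have h1 : max (x - y) 0 ≤ 1 := max_le (by linarith [hx.2, hy.1]) zero_le_one
    have h0 : 0 ≤ max (x - y) 0 := le_max_right _ _
    have h2 := hu y hy
    nlinarith [mul_le_mul_of_nonneg_left h2 h0]
  simpa using h

/-- The kernel is 1-Lipschitz in `x`. For a fixed continuous `u` the resulting constant is bounded
uniformly in `ν`, which later supplies equicontinuity. -/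
theorem abs_volterra_sub_le {u : ℝ → ℝ} (hu : Integrable u ν) (x x' : ℝ) :
    |volterra ν u x - volterra ν u x'| ≤ |x - x'| * ∫ y, |u y| ∂ν := by
  unfold volterra
  rw [← integral_sub (integrable_kernel_mul hu x) (integrable_kernel_mul hu x'),
    ← integral_const_mul]
  refine (abs_integral_le_integral_abs).trans (integral_mono ?_ (hu.abs.const_mul _) fun y => ?_)
  · exact ((integrable_kernel_mul hu x).sub (integrable_kernel_mul hu x')).abs
  · simp only
    rw [← sub_mul, abs_mul]
    exact mul_le_mul_of_nonneg_right (abs_kernel_sub_le x x' y) (abs_nonneg _)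

theorem continuous_volterra {u : ℝ → ℝ} (hu : Integrable u ν) : Continuous (volterra ν u) := by
  have : LipschitzWith (∫ y, |u y| ∂ν).toNNReal (volterra ν u) :=
    LipschitzWith.of_dist_le_mul fun x x' => by
      rw [Real.dist_eq, Real.dist_eq,
        Real.coe_toNNReal _ (integral_nonneg fun y => abs_nonneg (u y)), mul_comm]
      exact abs_volterra_sub_le hu x x'
  exact this.continuous

/-- Integrating the `ν`-primitive of `v` yields the Volterra operator. -/
theorem integral_primitive_eq_volterra {v : ℝ → ℝ} (hv : Integrable v ν) {x : ℝ}
    (hx : x ∈ Icc (0 : ℝ) 1) :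
    ∫ t in (0 : ℝ)..x, (∫ y in (0 : ℝ)..t, v y ∂ν) = volterra ν v x := by
  have hS : MeasurableSet {p : ℝ × ℝ | 0 < p.2 ∧ p.2 ≤ p.1} :=
    (measurableSet_lt measurable_const measurable_snd).inter
      (measurableSet_le measurable_snd measurable_fst)
  have hint : Integrable
      (Function.uncurry fun t y : ℝ => (Ioc 0 t).indicator v y)
      ((volume.restrict (Ioc 0 x)).prod ν) := by
    have h1 : Integrable (fun p : ℝ × ℝ => v p.2) ((volume.restrict (Ioc 0 x)).prod ν) :=
      hv.comp_snd _
    refine (h1.indicator hS).congr (Eventually.of_forall fun p => ?_)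
    simp [Function.uncurry, indicator]
  rw [intervalIntegral.integral_of_le hx.1]
  have e1 : ∫ t in Ioc 0 x, (∫ y in (0 : ℝ)..t, v y ∂ν) =
      ∫ t in Ioc 0 x, ∫ y, (Ioc 0 t).indicator v y ∂ν := by
    refine setIntegral_congr_fun measurableSet_Ioc fun t ht => ?_
    rw [intervalIntegral.integral_of_le ht.1.le, integral_indicator measurableSet_Ioc]
  -- After Fubini, `v y` is counted for `t ∈ [y, x]`, a set of length `(x - y)⁺`. The point `y = 0`,
  -- excluded by `Ioc 0 t`, is negligible because `ν` has no atoms.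
  rw [e1, integral_integral_swap hint]
  refine integral_congr_ae ?_
  filter_upwards [ae_mem_Icc (ν := ν), measure_eq_zero_iff_ae_notMem.1 (measure_singleton (μ := ν) 0)]
    with y hy hy0
  have hy1 : 0 < y := lt_of_le_of_ne hy.1 fun h => hy0 h.symm
  have e2 : ∀ t, (Ioc 0 t).indicator v y = (Ici y).indicator (fun _ => v y) t := fun t => by
    by_cases h : y ≤ t <;> simp [h, hy1]
  simp only [e2]
  rw [setIntegral_indicator measurableSet_Ici, setIntegral_const]
  have e3 : Ioc 0 x ∩ Ici y = Icc y x := by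
    ext t
    exact ⟨fun h => ⟨h.2, h.1.2⟩, fun h => ⟨⟨hy1.trans_le h.1, h.2⟩, h.1⟩⟩
  rw [e3, Measure.real, Real.volume_Icc, ENNReal.toReal_ofReal', smul_eq_mul]

theorem intervalIntegral_zero_one {v : ℝ → ℝ} : ∫ y in (0 : ℝ)..1, v y ∂ν = ∫ y, v y ∂ν := by
  rw [intervalIntegral.integral_of_le zero_le_one, ← integral_Icc_eq_integral_Ioc, restrict_Icc]

/-- A function with `ν`-Laplacian `v` is recovered from its initial values. -/
theorem HasMuLaplacian.eq_volterra {f v : ℝ → ℝ} (h : HasMuLaplacian ν f v)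
    (hv : Integrable v ν) {x : ℝ} (hx : x ∈ Icc (0 : ℝ) 1) :
    f x = f 0 + derivWithin f (Icc 0 1) 0 * x + volterra ν v x := by
  have hcont : Continuous fun t => derivWithin f (Icc 0 1) 0 + ∫ y in (0 : ℝ)..t, v y ∂ν :=
    continuous_const.add (intervalIntegral.continuous_primitive
      (fun _ _ => hv.intervalIntegrable) 0)
  have hp : Continuous fun t => ∫ y in (0 : ℝ)..t, v y ∂ν :=
    intervalIntegral.continuous_primitive (fun _ _ => hv.intervalIntegrable) 0
  have hftc := intervalIntegral.integral_eq_sub_of_hasDerivAt_of_le hx.1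
    (f := f) (f' := fun t => derivWithin f (Icc 0 1) 0 + ∫ y in (0 : ℝ)..t, v y ∂ν)
    (h.1.continuousOn.mono (Icc_subset_Icc_right hx.2))
    (fun t ht => by
      have htI : t ∈ Icc (0 : ℝ) 1 := ⟨ht.1.le, ht.2.le.trans hx.2⟩
      rw [← h.2 t htI]
      exact (h.1.differentiableOn one_ne_zero t htI).hasDerivWithinAt.hasDerivAt
        (Icc_mem_nhds ht.1 (ht.2.trans_le hx.2)))
    (hcont.intervalIntegrable _ _)
  rw [intervalIntegral.integral_add (by simp) (hp.intervalIntegrable _ _),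
    integral_primitive_eq_volterra hv hx, intervalIntegral.integral_const, smul_eq_mul] at hftc
  linarith

theorem hasDerivWithinAt_of_eq_volterra {f v : ℝ → ℝ} (hv : Integrable v ν) {a b : ℝ}
    (h : ∀ x ∈ Icc (0 : ℝ) 1, f x = a + b * x + volterra ν v x) {x : ℝ}
    (hx : x ∈ Icc (0 : ℝ) 1) :
    HasDerivWithinAt f (b + ∫ y in (0 : ℝ)..x, v y ∂ν) (Icc 0 1) x := by
  have hp : Continuous fun t => ∫ y in (0 : ℝ)..t, v y ∂ν :=
    intervalIntegral.continuous_primitive (fun _ _ => hv.intervalIntegrable) 0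
  have hd : HasDerivAt (fun z => a + b * z + ∫ t in (0 : ℝ)..z, ∫ y in (0 : ℝ)..t, v y ∂ν)
      (b + ∫ y in (0 : ℝ)..x, v y ∂ν) x := by
    have h1 := intervalIntegral.integral_hasDerivAt_right (hp.intervalIntegrable 0 x)
      (hp.stronglyMeasurableAtFilter _ _) hp.continuousAt
    have h2 := ((hasDerivAt_id x).const_mul b).const_add a
    rw [mul_one] at h2
    exact h2.add h1
  refine hd.hasDerivWithinAt.congr (fun z hz => ?_) ?_
  · rw [h z hz, integral_primitive_eq_volterra hv hz]
  · rw [h x hx, integral_primitive_eq_volterra hv hx]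

theorem derivWithin_of_eq_volterra {f v : ℝ → ℝ} (hv : Integrable v ν) {a b : ℝ}
    (h : ∀ x ∈ Icc (0 : ℝ) 1, f x = a + b * x + volterra ν v x) {x : ℝ}
    (hx : x ∈ Icc (0 : ℝ) 1) :
    derivWithin f (Icc 0 1) x = b + ∫ y in (0 : ℝ)..x, v y ∂ν :=
  (hasDerivWithinAt_of_eq_volterra hv h hx).derivWithin (uniqueDiffOn_Icc zero_lt_one x hx)

/-- Converse of `HasMuLaplacian.eq_volterra`; the derivative is continuous because primitives with
respect to a non-atomic measure are. -/
theorem hasMuLaplacian_of_eq_volterra {f v : ℝ → ℝ} (hv : Integrable v ν) {a b : ℝ}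
    (h : ∀ x ∈ Icc (0 : ℝ) 1, f x = a + b * x + volterra ν v x) : HasMuLaplacian ν f v := by
  have hp : Continuous fun t => ∫ y in (0 : ℝ)..t, v y ∂ν :=
    intervalIntegral.continuous_primitive (fun _ _ => hv.intervalIntegrable) 0
  refine ⟨?_, fun x hx => ?_⟩
  · rw [contDiffOn_one_iff_derivWithin (uniqueDiffOn_Icc zero_lt_one)]
    refine ⟨fun x hx => (hasDerivWithinAt_of_eq_volterra hv h hx).differentiableWithinAt, ?_⟩
    exact (continuous_const.add hp).continuousOn.congr
      fun x hx => derivWithin_of_eq_volterra hv h hx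
  · rw [derivWithin_of_eq_volterra hv h hx,
      derivWithin_of_eq_volterra hv h (left_mem_Icc.2 zero_le_one)]
    simp

/-- The Volterra operator is affine on the gaps of the support. -/
theorem volterra_gap {v : ℝ → ℝ} (hv : Integrable v ν) {l r t : ℝ}
    (hgap : ∀ y ∈ ν.support, y ≤ l ∨ r ≤ y) (ht : t ∈ Icc (0 : ℝ) 1) (hlr : l ≤ r) :
    volterra ν v (l + t * (r - l)) =
      volterra ν v l + t * (volterra ν v r - volterra ν v l) := by
  have hl := integrable_kernel_mul hv l
  have hr := integrable_kernel_mul hv r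
  unfold volterra
  rw [← integral_sub hr hl, ← integral_const_mul, 
    ← integral_add hl (Integrable.const_mul (hr.sub hl : Integrable (fun y => _ - _) ν) t)]
  refine integral_congr_ae ?_
  -- For `y` in the support, the kink of `x ↦ (x - y)⁺` lies outside `(l, r)`, so the kernel is
  -- affine there.
  filter_upwards [Measure.support_mem_ae (μ := ν)] with y hy
  have h1 : 0 ≤ t * (r - l) := mul_nonneg ht.1 (by linarith)
  have h2 : t * (r - l) ≤ 1 * (r - l) := mul_le_mul_of_nonneg_right ht.2 (by linarith)
  rcases hgap y hy with h | h
  · rw [max_eq_left (by linarith), max_eq_left (by linarith), max_eq_left (by linarith)]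
    ring
  · rw [max_eq_right (by linarith), max_eq_right (by linarith), max_eq_right (by linarith)]
    ring

end Volterra

/-! ### Gronwall estimates and the initial value problem. -/

section Estimates

variable {ν : Measure ℝ} [Admissible ν]

/-- On functions of growth `exp (k x)` the Volterra operator gains a factor `k⁻¹`. -/
theorem mul_volterra_le_exp {d : ℝ → ℝ} (hi : Integrable d ν) {k M : ℝ} (hk : 0 ≤ k) (hM : 0 ≤ M)
    (hd : ∀ y ∈ Icc (0 : ℝ) 1, d y ≤ M * Real.exp (k * y)) (x : ℝ) :
    k * volterra ν d x ≤ M * Real.exp (k * x) := by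
  have h : ∫ y, k * (max (x - y) 0 * d y) ∂ν ≤ ∫ _, M * Real.exp (k * x) ∂ν := by
    refine integral_mono_ae ((integrable_kernel_mul hi x).const_mul k) (integrable_const _) ?_
    filter_upwards [ae_mem_Icc (ν := ν)] with y hy
    have h0 : 0 ≤ max (x - y) 0 := le_max_right _ _
    have h1 : k * max (x - y) 0 * Real.exp (k * y) ≤ Real.exp (k * x) := by
      rcases le_total (x - y) 0 with h | h
      · rw [max_eq_right h]
        simpa using (Real.exp_pos (k * x)).le
      · rw [max_eq_left h]
        have h2 : k * (x - y) ≤ Real.exp (k * (x - y)) := by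
          linarith [Real.add_one_le_exp (k * (x - y))]
        calc k * (x - y) * Real.exp (k * y)
            ≤ Real.exp (k * (x - y)) * Real.exp (k * y) :=
              mul_le_mul_of_nonneg_right h2 (Real.exp_pos _).le
          _ = Real.exp (k * x) := by rw [← Real.exp_add]; ring_nf
    calc k * (max (x - y) 0 * d y) ≤ k * (max (x - y) 0 * (M * Real.exp (k * y))) :=
          mul_le_mul_of_nonneg_left (mul_le_mul_of_nonneg_left (hd y hy) h0) hk
      _ = M * (k * max (x - y) 0 * Real.exp (k * y)) := by ring
      _ ≤ M * Real.exp (k * x) := mul_le_mul_of_nonneg_left h1 hM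
  rw [integral_const_mul] at h
  simpa [volterra] using h

/-- A Gronwall inequality for the Volterra operator. -/
theorem le_of_le_add_volterra {d : ℝ → ℝ} (hd : ContinuousOn d (Icc 0 1)) {c ε : ℝ} (hc : 0 ≤ c)
    (hε : 0 ≤ ε) (h : ∀ x ∈ Icc (0 : ℝ) 1, d x ≤ ε + c * volterra ν d x) {x : ℝ}
    (hx : x ∈ Icc (0 : ℝ) 1) : d x ≤ 2 * Real.exp (2 * c) * ε := by
  -- The weight with rate `2 c` makes `c V` act with factor `1/2`: at the maximum point `z` the term
  -- `c V d` is at most half of `d z` and can be absorbed.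
  have hcont : ContinuousOn (fun y => Real.exp (-(2 * c * y)) * d y) (Icc 0 1) := by fun_prop
  obtain ⟨z, hz, hmax⟩ := isCompact_Icc.exists_isMaxOn ⟨0, left_mem_Icc.2 zero_le_one⟩ hcont
  set M := Real.exp (-(2 * c * z)) * d z with hMdef
  have hle : ∀ y ∈ Icc (0 : ℝ) 1, d y ≤ M * Real.exp (2 * c * y) := fun y hy => by
    have h1 : Real.exp (-(2 * c * y)) * d y ≤ M := hmax hy
    calc d y = Real.exp (-(2 * c * y)) * d y * Real.exp (2 * c * y) := by
          rw [mul_right_comm, ← Real.exp_add]; simp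
      _ ≤ M * Real.exp (2 * c * y) := mul_le_mul_of_nonneg_right h1 (Real.exp_pos _).le
  have hM : M ≤ 2 * ε := by
    rcases le_total M 0 with h0 | h0
    · linarith
    have h1 := mul_volterra_le_exp (integrable_of_continuousOn (ν := ν) hd)
      (by positivity : 0 ≤ 2 * c) h0 hle z
    have h2 : d z = M * Real.exp (2 * c * z) := by
      rw [hMdef, mul_right_comm, ← Real.exp_add]; simp
    have h3 : M * Real.exp (2 * c * z) ≤ 2 * ε := by linarith [h z hz]
    have h4 : 1 ≤ Real.exp (2 * c * z) :=
      Real.one_le_exp (mul_nonneg (by positivity) hz.1)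
    nlinarith
  have h5 : Real.exp (2 * c * x) ≤ Real.exp (2 * c) :=
    Real.exp_le_exp.2 (by nlinarith [hx.2])
  calc d x ≤ M * Real.exp (2 * c * x) := hle x hx
    _ ≤ 2 * ε * Real.exp (2 * c * x) := mul_le_mul_of_nonneg_right hM (Real.exp_pos _).le
    _ ≤ 2 * ε * Real.exp (2 * c) := mul_le_mul_of_nonneg_left h5 (by positivity)
    _ = 2 * Real.exp (2 * c) * ε := by ring

/-- Solutions of `u = h + c V u` with `h ≥ 0` satisfy `u ≥ h`. -/
theorem le_of_eq_add_volterra {u h : ℝ → ℝ} (hu : ContinuousOn u (Icc 0 1)) {c : ℝ} (hc : 0 ≤ c)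
    (hh : ∀ x ∈ Icc (0 : ℝ) 1, 0 ≤ h x)
    (heq : ∀ x ∈ Icc (0 : ℝ) 1, u x = h x + c * volterra ν u x) {x : ℝ}
    (hx : x ∈ Icc (0 : ℝ) 1) : h x ≤ u x := by
  have h0 : ∀ y ∈ Icc (0 : ℝ) 1, 0 ≤ u y := fun y hy => by
    -- Gronwall with error `0` for `-u`.
    have := le_of_le_add_volterra (ν := ν) (d := fun y => - u y) hu.neg hc le_rfl
      (fun x hx => by rw [volterra_neg]; linarith [heq x hx, hh x hx]) hy
    linarith
  rw [heq x hx]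
  linarith [mul_nonneg hc (volterra_nonneg (ν := ν) h0 x)]

/-- Solvability of `u = h + c V u` in the continuous functions. -/
theorem exists_eq_add_volterra {h : ℝ → ℝ} (hh : ContinuousOn h (Icc 0 1)) {c : ℝ} (hc : 0 ≤ c) :
    ∃ u : ℝ → ℝ, ContinuousOn u (Icc 0 1) ∧
      ∀ x ∈ Icc (0 : ℝ) 1, u x = h x + c * volterra ν u x := by
  -- Substituting `u = exp (2 c y) v` turns the equation into a fixed point problem for a
  -- `1/2`-contraction in the ordinary sup norm.
  let E : C(Icc (0 : ℝ) 1, ℝ) → ℝ → ℝ := fun v y =>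
    Real.exp (2 * c * y) * v (projIcc 0 1 zero_le_one y)
  have hE : ∀ v, Continuous (E v) := fun v =>
    (by fun_prop : Continuous fun y : ℝ => Real.exp (2 * c * y)).mul
      (v.continuous.comp continuous_projIcc)
  have hEi : ∀ v, Integrable (E v) ν := fun v => integrable_of_continuousOn (hE v).continuousOn
  let Φ : C(Icc (0 : ℝ) 1, ℝ) → C(Icc (0 : ℝ) 1, ℝ) := fun v =>
    ⟨fun x => Real.exp (-(2 * c * x)) * (h x + c * volterra ν (E v) x),
      (by fun_prop : Continuous fun x : Icc (0 : ℝ) 1 => Real.exp (-(2 * c * x))).mul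
        ((continuousOn_iff_continuous_domRestrict.1 hh).add
          (continuous_const.mul ((continuous_volterra (hEi v)).comp continuous_subtype_val)))⟩
  have hone : ∀ v w : C(Icc (0 : ℝ) 1, ℝ), ∀ x, Φ v x - Φ w x ≤ 1 / 2 * dist v w := by
    intro v w x
    have hb : ∀ y ∈ Icc (0 : ℝ) 1, E v y - E w y ≤ dist v w * Real.exp (2 * c * y) := by
      intro y _
      have h1 := ContinuousMap.dist_apply_le_dist (f := v) (g := w) (projIcc 0 1 zero_le_one y)
      rw [Real.dist_eq] at h1
      have h2 := (le_abs_self _).trans h1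
      simp only [E]
      nlinarith [Real.exp_pos (2 * c * y)]
    have h1 := mul_volterra_le_exp ((hEi v).sub (hEi w)) (by positivity : 0 ≤ 2 * c)
      dist_nonneg hb x
    have h2 : volterra ν (E v - E w) x = volterra ν (E v) x - volterra ν (E w) x :=
      volterra_sub (hEi v) (hEi w) x
    rw [h2] at h1
    have h3 : Φ v x - Φ w x = Real.exp (-(2 * c * x)) *
        (c * (volterra ν (E v) x - volterra ν (E w) x)) := by
      simp only [Φ, ContinuousMap.coe_mk]; ring
    rw [h3]
    calc Real.exp (-(2 * c * x)) * (c * (volterra ν (E v) x - volterra ν (E w) x))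
        ≤ Real.exp (-(2 * c * x)) * (1 / 2 * (dist v w * Real.exp (2 * c * x))) :=
          mul_le_mul_of_nonneg_left (by linarith) (Real.exp_pos _).le
      _ = 1 / 2 * dist v w * (Real.exp (-(2 * c * x)) * Real.exp (2 * c * x)) := by ring
      _ = 1 / 2 * dist v w := by rw [← Real.exp_add]; simp
  have hΦ : ContractingWith (1 / 2) Φ := by
    refine ⟨by norm_num, LipschitzWith.of_dist_le_mul fun v w => ?_⟩
    rw [ContinuousMap.dist_le (by positivity)]
    intro x
    rw [Real.dist_eq, abs_le]
    have h1 := hone v w x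
    have h2 := hone w v x
    rw [dist_comm w v] at h2
    push_cast
    constructor <;> linarith
  obtain ⟨v, hv⟩ : ∃ v, Φ v = v := ⟨_, hΦ.fixedPoint_isFixedPt⟩
  refine ⟨E v, (hE v).continuousOn, fun x hx => ?_⟩
  have h1 : Φ v ⟨x, hx⟩ = v ⟨x, hx⟩ := by rw [hv]
  have h2 : E v x = Real.exp (2 * c * x) * v ⟨x, hx⟩ := by
    simp only [E]; rw [projIcc_of_mem _ hx]
  rw [h2, ← h1]
  simp only [Φ, ContinuousMap.coe_mk]
  rw [← mul_assoc, ← Real.exp_add]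
  simp

/-- The lower estimate behind the stability of the boundary value problems. -/
theorem mul_sub_le_of_abs_sub_volterra_le {d q : ℝ → ℝ} (hd : ContinuousOn d (Icc 0 1))
    (hq : ∀ x ∈ Icc (0 : ℝ) 1, 0 ≤ q x) {c s ε : ℝ} (hc : 0 ≤ c) (hs : 0 ≤ s)
    (h : ∀ x ∈ Icc (0 : ℝ) 1, |d x - s * q x - c * volterra ν d x| ≤ ε) {x : ℝ}
    (hx : x ∈ Icc (0 : ℝ) 1) : s * q x - (1 + c * (2 * Real.exp (2 * c))) * ε ≤ d x := by
  have hε : 0 ≤ ε := (abs_nonneg _).trans (h x hx)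
  -- Gronwall for `-d`, where `-s q ≤ 0` may be dropped. This crude bound is then fed back into `c V
  -- d` to recover the term `s q`.
  have h1 : ∀ y ∈ Icc (0 : ℝ) 1, -(2 * Real.exp (2 * c) * ε) ≤ d y := fun y hy => by
    have := le_of_le_add_volterra (ν := ν) (d := fun y => - d y) hd.neg hc hε
      (fun x hx => by
        rw [volterra_neg]
        linarith [(abs_le.1 (h x hx)).1, mul_nonneg hs (hq x hx)]) hy
    linarith
  have h2 := neg_le_volterra (integrable_of_continuousOn (ν := ν) hd) (by positivity) h1 hx
  have h3 := mul_le_mul_of_nonneg_left h2 hc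
  linarith [(abs_le.1 (h x hx)).1]

end Estimates

/-! ### Boundary conditions and stability uniform in the measure. -/

/-- The profile of the free initial value: `1` for Neumann (`f'(0) = 0`, `f(0)` is free) and `x` for
Dirichlet (`f(0) = 0`, `f'(0)` is free) boundary conditions. -/
def BC.profile : BC → ℝ → ℝ
  | .neumann, _ => 1
  | .dirichlet, x => x

/-- The quantity that the boundary condition at `1` prescribes, for a function `d` with
`ν`-Laplacian `v`: it is `d'(1) = ∫ v dν` for Neumann and `d(1)` for Dirichlet. -/
noncomputable def BC.endValue (ν : Measure ℝ) : BC → (ℝ → ℝ) → (ℝ → ℝ) → ℝ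
  | .neumann, _, v => ∫ y, v y ∂ν
  | .dirichlet, d, _ => d 1

theorem BC.continuous_profile (b : BC) : Continuous b.profile := by
  cases b
  · exact continuous_const
  · exact continuous_id

theorem BC.profile_nonneg (b : BC) {x : ℝ} (hx : x ∈ Icc (0 : ℝ) 1) : 0 ≤ b.profile x := by
  cases b
  · exact zero_le_one
  · exact hx.1

theorem BC.profile_le_one (b : BC) {x : ℝ} (hx : x ∈ Icc (0 : ℝ) 1) : b.profile x ≤ 1 := by
  cases b
  · exact le_rfl
  · exact hx.2

section Stability

variable {ν : Measure ℝ} [Admissible ν]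

/-- If `d ≥ s q - m` on `[0,1]`, the end value controls `s`. -/
theorem BC.le_of_mul_profile_sub_le (b : BC) {d : ℝ → ℝ} (hd : ContinuousOn d (Icc 0 1))
    {c s m ε : ℝ} (hc : 0 < c) (h : ∀ x ∈ Icc (0 : ℝ) 1, s * b.profile x - m ≤ d x)
    (hend : b.endValue ν d (fun y => c * d y) ≤ ε) (hε : 0 ≤ ε) : s ≤ m + (1 + c⁻¹) * ε := by
  have hcε : 0 ≤ c⁻¹ * ε := by positivity
  -- Neumann: averaging `d ≥ s - m` over `ν` gives `s ≤ m + c⁻¹ ε`. Dirichlet: evaluating at `1`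
  -- gives `s ≤ m + ε`. The factor `1 + c⁻¹` covers both.
  cases b
  · have h1 : ∫ _, (s - m) ∂ν ≤ ∫ y, d y ∂ν := by
      refine integral_mono_ae (integrable_const _) (integrable_of_continuousOn hd) ?_
      filter_upwards [ae_mem_Icc (ν := ν)] with y hy
      simpa [BC.profile] using h y hy
    simp only [BC.endValue, integral_const_mul] at hend
    simp only [integral_const, probReal_univ, one_smul] at h1
    have h2 := mul_le_mul_of_nonneg_left hend (inv_nonneg.2 hc.le)
    rw [inv_mul_cancel_left₀ hc.ne'] at h2
    linarith
  · have h1 := h 1 (right_mem_Icc.2 zero_le_one)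
    simp only [BC.profile, BC.endValue] at h1 hend
    linarith

/-- The constant in the stability estimate. -/
noncomputable def stabilityConst (c : ℝ) : ℝ :=
  2 * Real.exp (2 * c) * ((1 + c * (2 * Real.exp (2 * c))) + (1 + c⁻¹) + 1)

/-- Stability of the boundary value problems for `c - Δ_ν`, uniformly in the measure `ν`. -/
theorem BC.abs_le_stabilityConst_mul (b : BC) {d : ℝ → ℝ} (hd : ContinuousOn d (Icc 0 1))
    {c s ε : ℝ} (hc : 0 < c)
    (h : ∀ x ∈ Icc (0 : ℝ) 1, |d x - s * b.profile x - c * volterra ν d x| ≤ ε)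
    (hend : |b.endValue ν d (fun y => c * d y)| ≤ ε) {x : ℝ} (hx : x ∈ Icc (0 : ℝ) 1) :
    |d x| ≤ stabilityConst c * ε := by
  have hε : 0 ≤ ε := (abs_nonneg _).trans hend
  set A := 1 + c * (2 * Real.exp (2 * c)) with hA
  have hA0 : 0 ≤ A := by positivity
  have hci : 0 < c⁻¹ := inv_pos.2 hc
  -- Only an upper bound on `s` is needed, since the hypotheses are invariant under `(d, s) ↦ (-d,
  -- -s)`.
  have key : ∀ (d : ℝ → ℝ) (s : ℝ), ContinuousOn d (Icc 0 1) →
      (∀ x ∈ Icc (0 : ℝ) 1, |d x - s * b.profile x - c * volterra ν d x| ≤ ε) →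
      |b.endValue ν d (fun y => c * d y)| ≤ ε → s ≤ (A + (1 + c⁻¹)) * ε := by
    intro d s hd h hend
    rcases le_total s 0 with hs | hs
    · exact hs.trans (by positivity)
    · have := b.le_of_mul_profile_sub_le hd hc (fun x hx => mul_sub_le_of_abs_sub_volterra_le hd
        (fun _ => b.profile_nonneg) hc.le hs h hx) ((le_abs_self _).trans hend) hε
      rw [add_mul]
      exact this
  have hneg : ∀ x ∈ Icc (0 : ℝ) 1,
      |(fun y => - d y) x - (-s) * b.profile x - c * volterra ν (fun y => - d y) x| ≤ ε := by
    intro x hx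
    rw [volterra_neg, ← abs_neg]
    convert h x hx using 2
    ring
  have hnegend : |b.endValue ν (fun y => - d y) (fun y => c * - d y)| ≤ ε := by
    rw [← abs_neg]
    convert hend using 2
    cases b
    · simp [BC.endValue, integral_neg]
    · simp [BC.endValue]
  have hs1 := key d s hd h hend
  have hs2 := key _ (-s) hd.neg hneg hnegend
  have gron : ∀ (d : ℝ → ℝ) (s : ℝ), s ≤ (A + (1 + c⁻¹)) * ε → ContinuousOn d (Icc 0 1) →
      (∀ x ∈ Icc (0 : ℝ) 1, |d x - s * b.profile x - c * volterra ν d x| ≤ ε) →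
      d x ≤ stabilityConst c * ε := by
    intro d s hs hd h
    -- With `s` bounded and `0 ≤ q ≤ 1`, the term `s q` joins the error.
    have := le_of_le_add_volterra (ν := ν) (ε := (A + (1 + c⁻¹) + 1) * ε) hd hc.le
      (by positivity) (fun x hx => by
        have h1 := (abs_le.1 (h x hx)).2
        have h2 := b.profile_nonneg hx
        have h3 := b.profile_le_one hx
        have h4 : s * b.profile x ≤ (A + (1 + c⁻¹)) * ε * b.profile x :=
          mul_le_mul_of_nonneg_right hs h2
        have h5 : (A + (1 + c⁻¹)) * ε * b.profile x ≤ (A + (1 + c⁻¹)) * ε * 1 :=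
          mul_le_mul_of_nonneg_left h3 (by positivity)
        linarith) hx
    rw [stabilityConst, ← hA, mul_assoc]
    exact this
  rw [abs_le]
  constructor
  · have hlow : - d x ≤ stabilityConst c * ε := gron (fun y => - d y) (-s) hs2 hd.neg hneg
    linarith
  · exact gron d s hs1 hd h

end Stability

theorem BC.endValue_congr_ae {ν : Measure ℝ} (b : BC) (d : ℝ → ℝ) {v w : ℝ → ℝ} (h : v =ᵐ[ν] w) :
    b.endValue ν d v = b.endValue ν d w := by
  cases b
  · exact integral_congr_ae h
  · rfl

/-! ### Bijectivity of `c - Δ_ν` and the representative of the resolvent. -/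

section Resolvent

variable {ν : Measure ℝ} [Admissible ν]

/-- The graph of the Krein-Feller operator in terms of the Volterra operator. -/
theorem mem_laplacianGraph_iff {b : BC} {U v : Lp ℝ 2 ν} :
    (U, v) ∈ laplacianGraph ν b ↔ ∃ u : ℝ → ℝ, ContinuousOn u (Icc 0 1) ∧ U =ᵐ[ν] u ∧
      ∃ s, (∀ x ∈ Icc (0 : ℝ) 1, u x = s * b.profile x + volterra ν v x) ∧
        b.endValue ν u v = 0 := by
  have hv := integrable_coe v
  have h0 : (0 : ℝ) ∈ Icc (0 : ℝ) 1 := left_mem_Icc.2 zero_le_one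
  have h1 : (1 : ℝ) ∈ Icc (0 : ℝ) 1 := right_mem_Icc.2 zero_le_one
  constructor
  · rintro ⟨f, hf, hb, hU⟩
    refine ⟨f, hf.1.continuousOn, hU, ?_⟩
    cases b
    · refine ⟨f 0, fun x hx => ?_, ?_⟩
      · rw [hf.eq_volterra hv hx, hb.1]
        simp [BC.profile]
      · have := hf.2 1 h1
        rw [hb.1, hb.2, intervalIntegral_zero_one, zero_add] at this
        exact this.symm
    · refine ⟨derivWithin f (Icc 0 1) 0, fun x hx => ?_, hb.2⟩
      rw [hf.eq_volterra hv hx, hb.1, zero_add]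
      rfl
  · rintro ⟨u, hu, hU, s, heq, hend⟩
    cases b
    · have heq' : ∀ x ∈ Icc (0 : ℝ) 1, u x = s + 0 * x + volterra ν v x := fun x hx => by
        rw [heq x hx]
        simp [BC.profile]
      refine ⟨u, hasMuLaplacian_of_eq_volterra hv heq', ⟨?_, ?_⟩, hU⟩
      · rw [derivWithin_of_eq_volterra hv heq' h0]
        simp
      · rw [derivWithin_of_eq_volterra hv heq' h1, intervalIntegral_zero_one, zero_add]
        exact hend
    · have heq' : ∀ x ∈ Icc (0 : ℝ) 1, u x = 0 + s * x + volterra ν v x := fun x hx => by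
        rw [heq x hx, zero_add]
        rfl
      refine ⟨u, hasMuLaplacian_of_eq_volterra hv heq', ⟨?_, hend⟩, hU⟩
      have hz : volterra ν v 0 = 0 := by
        rw [← integral_primitive_eq_volterra hv h0, intervalIntegral.integral_same]
      rw [heq' 0 h0, hz]
      simp

theorem mem_laplacianGraph_laplacian {b : BC} (U : (laplacian ν b).domain) :
    ((U : Lp ℝ 2 ν), laplacian ν b U) ∈ laplacianGraph ν b := by
  rw [← laplacian_graph]
  exact LinearPMap.mem_graph _ U

/-- The difference of two preimages solves the homogeneous problem, so stability with `ε = 0` makes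
it vanish. -/
theorem shifted_injective (b : BC) {c : ℝ} (hc : 0 < c) :
    Function.Injective (shifted ν b c) := by
  intro U W hUW
  have hmem := (laplacianGraph ν b).sub_mem (mem_laplacianGraph_laplacian U)
    (mem_laplacianGraph_laplacian W)
  have hv : laplacian ν b U - laplacian ν b W = c • ((U : Lp ℝ 2 ν) - W) := by
    simp only [shifted] at hUW
    rw [smul_sub]
    exact (sub_eq_sub_iff_sub_eq_sub.1 hUW).symm
  rw [Prod.mk_sub_mk, hv] at hmem
  obtain ⟨u, hu, hUu, s, heq, hend⟩ := mem_laplacianGraph_iff.1 hmem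
  have hae : (c • ((U : Lp ℝ 2 ν) - (W : Lp ℝ 2 ν)) : Lp ℝ 2 ν) =ᵐ[ν] fun y => c * u y := by
    filter_upwards [Lp.coeFn_smul c ((U : Lp ℝ 2 ν) - (W : Lp ℝ 2 ν)), hUu] with y h1 h2
    rw [h1, Pi.smul_apply, h2, smul_eq_mul]
  rw [b.endValue_congr_ae u hae] at hend
  have hz : ∀ x ∈ Icc (0 : ℝ) 1, u x = 0 := fun x hx => by
    have := b.abs_le_stabilityConst_mul (ν := ν) (s := s) (ε := 0) hu hc (fun x hx => by
      rw [heq x hx, volterra_congr_ae hae, volterra_const_mul]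
      simp) (by rw [hend, abs_zero]) hx
    rw [mul_zero] at this
    exact abs_nonpos_iff.1 this
  have h0 : (U : Lp ℝ 2 ν) - W = 0 := by
    refine Lp.eq_zero_iff_ae_eq_zero.2 ?_
    filter_upwards [hUu, ae_mem_Icc (ν := ν)] with y h1 h2
    rw [h1, hz y h2]
    rfl
  exact Subtype.ext (sub_eq_zero.1 h0)

/-- Solvability of the boundary value problem `(c - Δ_ν) u = g`. -/
theorem BC.exists_solution (b : BC) {g : ℝ → ℝ} (hg : Integrable g ν) {c : ℝ} (hc : 0 < c) :
    ∃ u : ℝ → ℝ, ContinuousOn u (Icc 0 1) ∧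
      ∃ s, (∀ x ∈ Icc (0 : ℝ) 1,
        u x = s * b.profile x + volterra ν (fun y => c * u y - g y) x) ∧
        b.endValue ν u (fun y => c * u y - g y) = 0 := by
  -- Shooting: `w` solves the inhomogeneous equation with zero initial data, `φ` the homogeneous one
  -- with unit free initial value, and `s` is chosen so that the end value of `w + s φ` vanishes.
  obtain ⟨w, hw, hweq⟩ := exists_eq_add_volterra (ν := ν) (h := fun x => - volterra ν g x)
    (continuous_volterra hg).neg.continuousOn hc.le
  obtain ⟨φ, hφ, hφeq⟩ := exists_eq_add_volterra (ν := ν)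
    b.continuous_profile.continuousOn hc.le
  have hge : ∀ x ∈ Icc (0 : ℝ) 1, b.profile x ≤ φ x := fun x hx =>
    le_of_eq_add_volterra hφ hc.le (fun _ => b.profile_nonneg) hφeq hx
  have hwi := integrable_of_continuousOn (ν := ν) hw
  have hφi := integrable_of_continuousOn (ν := ν) hφ
  -- Since `φ ≥ q`, a nonpositive end value would give `1 ≤ 0`.
  have hpos : 0 < b.endValue ν φ (fun y => c * φ y) := by
    by_contra hle
    have := b.le_of_mul_profile_sub_le (ν := ν) (s := 1) (m := 0) (ε := 0) hφ hc
      (fun x hx => by simpa using hge x hx) (not_lt.1 hle) le_rfl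
    norm_num at this
  set s := - b.endValue ν w (fun y => c * w y - g y) / b.endValue ν φ (fun y => c * φ y) with hs
  refine ⟨fun x => w x + s * φ x, hw.add (hφ.const_smul s), s, fun x hx => ?_, ?_⟩
  · have hui : Integrable (fun y => w y + s * φ y) ν := hwi.add (hφi.const_mul s)
    rw [volterra_sub (hui.const_mul c) hg, volterra_const_mul,
      volterra_add hwi (hφi.const_mul s), volterra_const_mul]
    linear_combination hweq x hx + s * hφeq x hx
  · have hlin : b.endValue ν (fun x => w x + s * φ x) (fun y => c * (w y + s * φ y) - g y) =
        b.endValue ν w (fun y => c * w y - g y) + s * b.endValue ν φ (fun y => c * φ y) := by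
      cases b
      · have h1 : Integrable (fun y => c * w y - g y) ν := (hwi.const_mul c).sub hg
        simp only [BC.endValue]
        rw [← integral_const_mul, ← integral_add h1 ((hφi.const_mul c).const_mul s)]
        congr 1
        ext y
        ring
      · rfl
    rw [hlin, hs, div_mul_cancel₀ _ hpos.ne', add_neg_cancel]

theorem shifted_surjective (b : BC) {c : ℝ} (hc : 0 < c) :
    Function.Surjective (shifted ν b c) := by
  intro g
  obtain ⟨u, hu, s, heq, hend⟩ := b.exists_solution (integrable_coe g) hc
  set U : Lp ℝ 2 ν := (memLp_of_continuousOn hu).toLp u with hUdef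
  have hUu : U =ᵐ[ν] u := MemLp.coeFn_toLp _
  have hae : (c • U - g : Lp ℝ 2 ν) =ᵐ[ν] fun y => c * u y - g y := by
    filter_upwards [Lp.coeFn_sub (c • U) g, Lp.coeFn_smul c U, hUu] with y h1 h2 h3
    rw [h1, Pi.sub_apply, h2, Pi.smul_apply, h3, smul_eq_mul]
  have hmem : (U, c • U - g) ∈ laplacianGraph ν b :=
    mem_laplacianGraph_iff.2 ⟨u, hu, hUu, s, fun x hx => by
      rw [volterra_congr_ae hae]; exact heq x hx, by
      rw [b.endValue_congr_ae u hae]; exact hend⟩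
  rw [← laplacian_graph, LinearPMap.mem_graph_iff] at hmem
  obtain ⟨W, hW, hLW⟩ := hmem
  refine ⟨W, ?_⟩
  simp only at hW hLW
  rw [shifted, hLW, hW, sub_sub_cancel]

theorem shifted_bijective (b : BC) {c : ℝ} (hc : 0 < c) :
    Function.Bijective (shifted ν b c) :=
  ⟨shifted_injective b hc, shifted_surjective b hc⟩

/-- The resolvent solves the boundary value problem, and the distinguished representative of its
values is the solution. -/
theorem exists_resolventC_eq {b : BC} {c : ℝ} (hc : 0 < c) (f : CSpace ν b) {g : ℝ → ℝ}
    (hg : f.1 =ᵐ[ν] g) :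
    ∃ u : ℝ → ℝ, ContinuousOn u (Icc 0 1) ∧ (resolventC ν b c f).1 =ᵐ[ν] u ∧
      (∀ x ∈ Icc (0 : ℝ) 1, rep (resolventC ν b c f) x = u x) ∧
      ∃ s, (∀ x ∈ Icc (0 : ℝ) 1,
        u x = s * b.profile x + volterra ν (fun y => c * u y - g y) x) ∧
        b.endValue ν u (fun y => c * u y - g y) = 0 := by
  set W := resolvent ν b c f.1 with hW
  have hshift : shifted ν b c W = f.1 :=
    Function.rightInverse_invFun (shifted_surjective b hc) f.1
  obtain ⟨u, hu, hUu, s, heq, hend⟩ :=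
    mem_laplacianGraph_iff.1 (mem_laplacianGraph_laplacian W)
  have hLW : laplacian ν b W = c • (W : Lp ℝ 2 ν) - f.1 := by
    rw [← hshift, shifted, sub_sub_cancel]
  have hae : (laplacian ν b W : Lp ℝ 2 ν) =ᵐ[ν] fun y => c * u y - g y := by
    rw [hLW]
    filter_upwards [Lp.coeFn_sub (c • (W : Lp ℝ 2 ν)) f.1, Lp.coeFn_smul c (W : Lp ℝ 2 ν), hUu, hg]
      with y h1 h2 h3 h4
    rw [h1, Pi.sub_apply, h2, Pi.smul_apply, h3, h4, smul_eq_mul]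
  have hR : (resolventC ν b c f).1 =ᵐ[ν] u := hUu
  have hsupp : ∀ x ∈ ν.support, rep (resolventC ν b c f) x = u x := fun x hx => by
    have := eq_zero_on_support (μ := ν) (f := fun x => rep (resolventC ν b c f) x - u x)
      ((continuousOn_rep _).sub hu) (by
        filter_upwards [coe_ae_eq_rep (resolventC ν b c f), hR] with y h1 h2
        rw [← h1, h2, sub_self]
        rfl) hx
    linarith
  refine ⟨u, hu, hR, fun x hx => ?_, s, fun x hx => ?_, ?_⟩
  -- Off the support, `rep` is affine on each gap by construction and `u` by its equation, so
  -- agreement at the end points of the gap suffices.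
  · obtain ⟨l, hl, r, hr, hgap, hxlr, -, -⟩ := exists_gap (Measure.isClosed_support (μ := ν))
      Admissible.zero_mem Admissible.one_mem hx
    have hlr : l ≤ r := hxlr.1.trans hxlr.2
    have hrep : rep (resolventC ν b c f) x = u l + (x - l) / (r - l) * (u r - u l) := by
      rw [← hsupp l hl, ← hsupp r hr]
      unfold rep
      rw [gapLinear_of_gap hl hr hgap hxlr, gapLinear_of_mem hl, gapLinear_of_mem hr]
    rw [hrep]
    set t := (x - l) / (r - l) with ht
    -- The gap may be degenerate: for `l = r`, division by zero gives `t = 0`, and `x = l`.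
    have ht0 : 0 ≤ t := div_nonneg (by linarith [hxlr.1]) (by linarith)
    have ht1 : t ≤ 1 := div_le_one_of_le₀ (by linarith [hxlr.2]) (by linarith)
    have hxt : x = l + t * (r - l) := by
      rcases eq_or_lt_of_le hlr with h | h
      · rw [← h, sub_self, mul_zero, add_zero]
        exact le_antisymm (by rw [h]; exact hxlr.2) hxlr.1
      · rw [ht, div_mul_cancel₀ _ (sub_ne_zero.2 h.ne')]
        ring
    have hprof : b.profile x = b.profile l + t * (b.profile r - b.profile l) := by
      cases b
      · simp [BC.profile]
      · exact hxt
    have hvol := volterra_gap (integrable_coe (laplacian ν b W)) hgap ⟨ht0, ht1⟩ hlr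
    rw [← hxt] at hvol
    rw [heq x hx, heq l (support_subset hl), heq r (support_subset hr), hprof, hvol]
    ring
  · rw [heq x hx, volterra_congr_ae hae]
  · rw [← b.endValue_congr_ae u hae]
    exact hend

end Resolvent

/-! ### Convergence under weak convergence of the measures. -/

section Convergence

variable {μ : Measure ℝ} [Admissible μ] {μn : ℕ → Measure ℝ} [∀ n, Admissible (μn n)]

/-- All measures are carried by `[0,1]`, so composing with the projection onto `[0,1]` yields a
bounded continuous test function with the same integrals. -/
theorem tendsto_integral_of_continuousOn
    (hweak : Tendsto (fun n => toProb (μn n)) atTop (𝓝 (toProb μ)))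
    {φ : ℝ → ℝ} (hφ : ContinuousOn φ (Icc 0 1)) :
    Tendsto (fun n => ∫ y, φ y ∂(μn n)) atTop (𝓝 (∫ y, φ y ∂μ)) := by
  let ψ : BoundedContinuousFunction ℝ ℝ :=
    (BoundedContinuousFunction.mkOfCompact
      ⟨(Icc (0 : ℝ) 1).domRestrict φ, continuousOn_iff_continuous_domRestrict.1 hφ⟩).compContinuous
      ⟨projIcc 0 1 zero_le_one, continuous_projIcc⟩
  have hψ : ∀ (ν : Measure ℝ) [Admissible ν], ∫ y, φ y ∂ν = ∫ y, ψ y ∂ν := fun ν _ => by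
    refine integral_congr_ae ?_
    filter_upwards [ae_mem_Icc (ν := ν)] with y hy
    simp [ψ, projIcc_of_mem _ hy]
  have h := ProbabilityMeasure.tendsto_iff_forall_integral_tendsto.1 hweak ψ
  simp only [hψ]
  exact h

/-- For fixed `x` this is weak convergence tested against `(x - y)⁺ G(y)`. A Lipschitz constant
common to all the measures makes it uniform through a finite net. -/
theorem eventually_abs_volterra_sub_le
    (hweak : Tendsto (fun n => toProb (μn n)) atTop (𝓝 (toProb μ)))
    {G : ℝ → ℝ} (hG : ContinuousOn G (Icc 0 1)) {ε : ℝ} (hε : 0 < ε) :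
    ∀ᶠ n in atTop, ∀ x ∈ Icc (0 : ℝ) 1, |volterra (μn n) G x - volterra μ G x| ≤ ε := by
  obtain ⟨B, hB⟩ := isCompact_Icc.exists_bound_of_continuousOn hG
  have hB0 : 0 ≤ B := (norm_nonneg _).trans (hB 0 (left_mem_Icc.2 zero_le_one))
  have hint : ∀ (ν : Measure ℝ) [Admissible ν], ∫ y, |G y| ∂ν ≤ B := fun ν _ => by
    have h : ∫ y, |G y| ∂ν ≤ ∫ _, B ∂ν := by
      refine integral_mono_ae (integrable_of_continuousOn hG).abs (integrable_const _) ?_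
      filter_upwards [ae_mem_Icc (ν := ν)] with y hy using hB y hy
    simpa using h
  -- `B + 1` rather than `B`, as `B` may be `0`.
  set δ := ε / (3 * (B + 1)) with hδ
  have hδ0 : 0 < δ := by positivity
  have hδB : δ * B ≤ ε / 3 := by
    have h1 : δ * (B + 1) = ε / 3 := by rw [hδ]; field_simp
    nlinarith
  have hlip : ∀ (ν : Measure ℝ) [Admissible ν], ∀ x x', |x - x'| ≤ δ →
      |volterra ν G x - volterra ν G x'| ≤ ε / 3 := fun ν _ x x' h =>
    (abs_volterra_sub_le (integrable_of_continuousOn hG) x x').trans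
      ((mul_le_mul h (hint ν) (integral_nonneg fun y => abs_nonneg (G y)) hδ0.le).trans hδB)
  obtain ⟨t, -, htf, hcov⟩ := (isCompact_Icc (a := (0 : ℝ)) (b := 1)).finite_cover_balls hδ0
  have hev : ∀ᶠ n in atTop, ∀ z ∈ t, |volterra (μn n) G z - volterra μ G z| < ε / 3 := by
    refine (eventually_all_finite htf).2 fun z _ => ?_
    have h1 := tendsto_integral_of_continuousOn hweak
      (φ := fun y => max (z - y) 0 * G y) (by fun_prop)
    have h2 := Metric.tendsto_nhds.1 h1 (ε / 3) (by positivity)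
    simpa only [Real.dist_eq, volterra] using h2
  filter_upwards [hev] with n hn x hx
  obtain ⟨z, hz, hxz⟩ := mem_iUnion₂.1 (hcov hx)
  have hxz' : |x - z| ≤ δ := by
    rw [← Real.dist_eq]
    exact (Metric.mem_ball.1 hxz).le
  have h1 := abs_le.1 (hlip (μn n) x z hxz')
  have h2 := abs_le.1 (hlip μ x z hxz')
  have h3 := abs_lt.1 (hn z hz)
  rw [abs_le]
  constructor <;> linarith [h1.1, h1.2, h2.1, h2.2, h3.1, h3.2]

/-- Solutions of the boundary value problems depend continuously on the measure. -/
theorem eventually_abs_solution_sub_le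
    (hweak : Tendsto (fun n => toProb (μn n)) atTop (𝓝 (toProb μ))) (b : BC) {c : ℝ} (hc : 0 < c)
    {g u : ℝ → ℝ} (hg : ContinuousOn g (Icc 0 1)) (hu : ContinuousOn u (Icc 0 1)) {s : ℝ}
    (heq : ∀ x ∈ Icc (0 : ℝ) 1,
      u x = s * b.profile x + volterra μ (fun y => c * u y - g y) x)
    (hend : b.endValue μ u (fun y => c * u y - g y) = 0)
    {un : ℕ → ℝ → ℝ} (hun : ∀ n, ContinuousOn (un n) (Icc 0 1)) {sn : ℕ → ℝ}
    (heqn : ∀ n, ∀ x ∈ Icc (0 : ℝ) 1,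
      un n x = sn n * b.profile x + volterra (μn n) (fun y => c * un n y - g y) x)
    (hendn : ∀ n, b.endValue (μn n) (un n) (fun y => c * un n y - g y) = 0)
    {ε : ℝ} (hε : 0 < ε) :
    ∀ᶠ n in atTop, ∀ x ∈ Icc (0 : ℝ) 1, |un n x - u x| ≤ ε := by
  have hC : 0 < stabilityConst c := by
    unfold stabilityConst
    positivity
  have hη : 0 < ε / stabilityConst c := div_pos hε hC
  have hG : ContinuousOn (fun y => c * u y - g y) (Icc 0 1) := (hu.const_smul c).sub hg
  have hendev : ∀ᶠ n in atTop,
      |b.endValue (μn n) (fun x => un n x - u x) (fun y => c * (un n y - u y))| ≤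
        ε / stabilityConst c := by
    cases b
    · have h1 := tendsto_integral_of_continuousOn hweak hG
      simp only [BC.endValue] at hend hendn ⊢
      rw [hend] at h1
      filter_upwards [Metric.tendsto_nhds.1 h1 _ hη] with n hn
      rw [Real.dist_eq, sub_zero] at hn
      -- Subtracting the end condition of `un n` leaves the integral of a fixed continuous function,
      -- whose limit is the end value of `u`, namely `0`.
      have h2 : ∫ y, c * (un n y - u y) ∂(μn n) = - ∫ y, (c * u y - g y) ∂(μn n) := by
        have h3 := integral_sub
          (integrable_of_continuousOn (ν := μn n) (((hun n).const_smul c).sub hg))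
          (integrable_of_continuousOn (ν := μn n) hG)
        rw [← zero_sub, ← hendn n]
        refine Eq.trans (integral_congr_ae (Eventually.of_forall fun y => ?_)) h3
        simp only [Pi.sub_apply, Pi.smul_apply, smul_eq_mul]
        ring
      rw [h2, abs_neg]
      exact hn.le
    · refine Eventually.of_forall fun n => ?_
      simp only [BC.endValue] at hend hendn ⊢
      rw [hendn n, hend, sub_zero, abs_zero]
      exact hη.le
  filter_upwards [hendev, eventually_abs_volterra_sub_le hweak hG hη] with n hn1 hn2 x hx
  have hui := integrable_of_continuousOn (ν := μn n) hu
  have huni := integrable_of_continuousOn (ν := μn n) (hun n)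
  have hgi := integrable_of_continuousOn (ν := μn n) hg
  -- The residual of `un n - u` in the `μn n`-equation is exactly `(V_{μn n} - V_μ)(c u - g)`.
  have h := b.abs_le_stabilityConst_mul (ν := μn n) (d := fun y => un n y - u y) (s := sn n - s)
    ((hun n).sub hu) hc
    (fun x hx => by
      have h1 := hn2 x hx
      convert h1 using 2
      have e1 := volterra_sub huni hui x
      have e2 := heqn n x hx
      have e3 := heq x hx
      rw [volterra_sub (huni.const_mul c) hgi, volterra_const_mul] at e2
      rw [volterra_sub (hui.const_mul c) hgi, volterra_const_mul, e1]
      linear_combination e2 - e3) hn1 hx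
  rwa [mul_div_cancel₀ _ hC.ne'] at h

theorem coe_embed_ae_eq {ν : Measure ℝ} [Admissible ν] {b : BC} (f : CSpace μ b) :
    (embed ν f).1 =ᵐ[ν] rep f :=
  MemLp.coeFn_toLp (memLp_of_continuousOn (continuousOn_rep f))

theorem tendsto_supNorm_resolventC_sub
    (hweak : Tendsto (fun n => toProb (μn n)) atTop (𝓝 (toProb μ))) {b : BC} {c : ℝ} (hc : 0 < c)
    (f : CSpace μ b) :
    Tendsto (fun n => supNorm (resolventC (μn n) b c (embed (μn n) f) -
      embed (μn n) (resolventC μ b c f))) atTop (𝓝 0) := by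
  obtain ⟨u, hu, -, hrep, s, heq, hend⟩ := exists_resolventC_eq hc f (coe_ae_eq_rep f)
  have hn : ∀ n, _ := fun n => exists_resolventC_eq (ν := μn n) hc (embed (μn n) f)
    (g := rep f) (coe_embed_ae_eq f)
  choose un hun hunae _ sn heqn hendn using hn
  rw [Metric.tendsto_nhds]
  intro ε hε
  filter_upwards [eventually_abs_solution_sub_le hweak b hc (continuousOn_rep f) hu heq hend
    hun heqn hendn (half_pos hε)] with n hn
  have hle : ∀ x : (μn n).support, |rep (resolventC (μn n) b c (embed (μn n) f) -
      embed (μn n) (resolventC μ b c f)) x| ≤ ε / 2 := by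
    intro x
    -- `rep` of a difference involves its own choice of representative, but on `supp (μn n)` all
    -- continuous representatives agree, so `un n - u` may replace it.
    have hz := eq_zero_on_support (μ := μn n)
      (f := fun x => rep (resolventC (μn n) b c (embed (μn n) f) -
        embed (μn n) (resolventC μ b c f)) x - (un n x - u x))
      ((continuousOn_rep _).sub ((hun n).sub hu)) (by
        filter_upwards [coe_ae_eq_rep (resolventC (μn n) b c (embed (μn n) f) -
          embed (μn n) (resolventC μ b c f)), hunae n,
          coe_embed_ae_eq (ν := μn n) (resolventC μ b c f), ae_mem_Icc (ν := μn n),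
          Lp.coeFn_sub (resolventC (μn n) b c (embed (μn n) f)).1
            (embed (μn n) (resolventC μ b c f)).1] with y h1 h2 h3 h4 h5
        rw [← h1, AddSubgroupClass.coe_sub, h5, Pi.sub_apply, h2, h3, hrep y h4, sub_self]
        rfl) x.2
    rw [sub_eq_zero.1 hz]
    exact hn x (support_subset x.2)
  have hnonneg : 0 ≤ supNorm (resolventC (μn n) b c (embed (μn n) f) -
      embed (μn n) (resolventC μ b c f)) := Real.iSup_nonneg fun x => abs_nonneg _
  rw [Real.dist_eq, sub_zero, abs_of_nonneg hnonneg]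
  exact (Real.iSup_le hle (half_pos hε).le).trans_lt (half_lt_self hε)

end Convergence

end KreinFeller

theorem theorem5p4 (μ : MeasureTheory.Measure ℝ) [KreinFeller.Admissible μ]
    (μn : ℕ → MeasureTheory.Measure ℝ) [∀ n, KreinFeller.Admissible (μn n)]
    (hweak : Filter.Tendsto (fun n => KreinFeller.toProb (μn n)) Filter.atTop
      (nhds (KreinFeller.toProb μ)))
    (hsupp : ∀ n, μ.support ⊆ (μn n).support)
    (b : KreinFeller.BC) (c : ℝ) (hc : 0 < c) :
    -- the resolvent operators are well defined
    Function.Bijective (KreinFeller.shifted μ b c) ∧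
    (∀ n, Function.Bijective (KreinFeller.shifted (μn n) b c)) ∧
    -- the convergence of the resolvents
    ∀ f : KreinFeller.CSpace μ b,
      Filter.Tendsto
        (fun n => KreinFeller.supNorm (KreinFeller.resolventC (μn n) b c (KreinFeller.embed (μn n) f) -
          KreinFeller.embed (μn n) (KreinFeller.resolventC μ b c f)))
        Filter.atTop (nhds 0) := by
  exact ⟨KreinFeller.shifted_bijective b hc, fun n => KreinFeller.shifted_bijective b hc,
    KreinFeller.tendsto_supNorm_resolventC_sub hweak hc⟩
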